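/- Consider a slotted downlink with a base station and $N\ge 2$ users, and constants $T_s,BW,P,\sigma>0$ (slot length, bandwidth, total power, noise power). The vectors of channel gains $h(t)=(h_1(t),\dots,h_N(t))\ge 0$, $t=0,1,2,\dots$, are i.i.d. over slots with law $\nu$, the vectors of arrivals $a(t)=(a_1(t),\dots,a_N(t))$, with $0\le a_n(t)\le a_{\max}$, are i.i.d. over slots with mean $\lambda=(\lambda_1,\dots,\lambda_N)$, and the two processes are independent. In slot $t$ a scheduler using two-layer hierarchical modulation picks two users $n\ne m$ with $h_n(t)\le h_m(t)$ and a power $p\in[0,P]$; user $n$ (base layer, power $P-p$) and user $m$ (incremental layer, power $p$) are then offered the service $$\mu_n^b(t)=T_s\,BW\log\Bigl(1+\frac{h_n(t)(P-p)}{h_n(t)p+\sigma}\Bigr),\qquad \mu_m^i(t)=T_s\,BW\log\Bigl(1+\frac{h_m(t)p}{\sigma}\Bigr),$$ and the other users are offered none. All service rates that can be offered are assumed to be bounded by a constant $\mu_{\max}$. If $\mu_k(t)$ denotes the service offered to user $k$, then $q_k(t+1)=\max\{q_k(t)+a_k(t)-\mu_k(t),0\}$, with a deterministic initial vector $q(0)\ge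 0$. A network is stable if $\limsup_{T\to\infty}\frac1T\sum_{t=0}^{T-1}\mathbb E[q_n(t)]<\infty$ for every user $n$. Let $\Lambda_h$, the rate region, be the closure of the set of all $\lambda$ for which there are a network as above with channel law $\nu$ and arrival rate vector $\lambda$, an initial vector $q(0)\ge 0$, and a scheduler of the above kind (causal, possibly randomized and dependent on the whole past) under which it is stable. Max-Weight with Hierarchical Modulation (MWHM) picks in every slot, as a measurable function of $q(t)$ and $h(t)$, users $n\ne m$ with $h_n(t)\le h_m(t)$ and $p\in[0,P]$ that maximize $q_n(t)\mu_n^b(t)+q_m(t)\mu_m^i(t)$, ties being broken arbitrarily. If $\lambda$ lies strictly within $\Lambda_h$, that is, $\lambda+\varepsilon(1,\dots,1)\in\Lambda_h$ for some $\varepsilon>0$, then MWHM stabilizes every network with channel law $\nu$ and arrival rate vector $\lambda$, from every initial vector $q(0)\ge 0$, and the queue process is positive recurrent: there is an $R$ such that the expectation of the first $t\ge 1$ with $\sum_n q_n(t)\le R$ is finite for every $q(0)\ge 0$, and bounded uniformly over bounded sets of $q(0)$. Moreover MWHM is throughput optimal: the closure of the set of all $\lambda\ge 0$ such that MWHM stabilizes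 every network with channel law $\nu$ and arrival rate vector $\lambda$, from every $q(0)\ge 0$, is the whole of $\Lambda_h$. -/

import Mathlib

open MeasureTheory ProbabilityTheory Filter
open scoped ENNReal

noncomputable section

/-- Physical constants of the downlink: slot length `Ts`, bandwidth `BW`, total transmission
power `P` of the base station, and noise power `noise`. -/
structure HMSystem where
  Ts : ℝ
  BW : ℝ
  P : ℝ
  noise : ℝ
  Ts_pos : 0 < Ts
  BW_pos : 0 < BW
  P_pos : 0 < P
  noise_pos : 0 < noise

namespace HMSystem

variable {N : ℕ}

/-- A scheduling decision `(n, m, p)`: user `n` is served on the base layer with power `P - p`,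
user `m` on the incremental layer with power `p`. -/
abbrev Decision (N : ℕ) : Type := Fin N × Fin N × ℝ

/-- Rate of a base-layer user of gain `x` if the incremental layer has power `p` (so that
the base layer has power `P - p`). -/
def baseRate (S : HMSystem) (x p : ℝ) : ℝ :=
  S.Ts * S.BW * Real.log (1 + x * (S.P - p) / (x * p + S.noise))

/-- Rate of an incremental-layer user of gain `x` if the incremental layer has power `p`. -/
def incRate (S : HMSystem) (x p : ℝ) : ℝ :=
  S.Ts * S.BW * Real.log (1 + x * p / S.noise)

/-- The decisions allowed when the vector of channel gains is `g`: two different users, the one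
with the worse channel on the base layer, and any split of the total power. -/
def Admissible (S : HMSystem) (g : Fin N → ℝ) (d : Decision N) : Prop :=
  d.1 ≠ d.2.1 ∧ g d.1 ≤ g d.2.1 ∧ 0 ≤ d.2.2 ∧ d.2.2 ≤ S.P

/-- The service offered to each user by decision `d` when the gains are `g`. -/
def service (S : HMSystem) (g : Fin N → ℝ) (d : Decision N) (k : Fin N) : ℝ :=
  if k = d.1 then S.baseRate (g k) d.2.2
  else if k = d.2.1 then S.incRate (g k) d.2.2
  else 0

/-- The weight `q_n μ_n^b + q_m μ_m^i` of decision `(n, m, p)`. -/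
def weight (S : HMSystem) (q g : Fin N → ℝ) (d : Decision N) : ℝ :=
  q d.1 * S.baseRate (g d.1) d.2.2 + q d.2.1 * S.incRate (g d.2.1) d.2.2

/-- One slot of the queue dynamics. -/
def step (S : HMSystem) (q g a : Fin N → ℝ) (d : Decision N) : Fin N → ℝ :=
  fun k => max (q k + a k - S.service g d k) 0

/-- Queue vectors along a path of gains `g`, arrivals `a` and decisions `d`, started at `q0`. -/
def queue (S : HMSystem) (q0 : Fin N → ℝ) (g a : ℕ → Fin N → ℝ) (d : ℕ → Decision N) :
    ℕ → Fin N → ℝ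
  | 0 => q0
  | t + 1 => S.step (queue S q0 g a d t) (g t) (a t) (d t)

/-- Queue vectors along a path of gains `g` and arrivals `a`, started at `q0`, when the decision
of each slot is `φ` applied to the current queues and the current gains. -/
def ruleQueue (S : HMSystem) (φ : (Fin N → ℝ) → (Fin N → ℝ) → Decision N) (q0 : Fin N → ℝ)
    (g a : ℕ → Fin N → ℝ) : ℕ → Fin N → ℝ
  | 0 => q0
  | t + 1 => S.step (ruleQueue S φ q0 g a t) (g t) (a t) (φ (ruleQueue S φ q0 g a t) (g t))

/-- `φ` is a Max-Weight with Hierarchical Modulation scheduler: from the current queues and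
gains it selects an admissible pair and power split of maximal weight (ties are broken in an
arbitrary measurable way). -/
def IsMWHM (S : HMSystem) (φ : (Fin N → ℝ) → (Fin N → ℝ) → Decision N) : Prop :=
  Measurable (Function.uncurry φ) ∧
  ∀ q g : Fin N → ℝ, (∀ n, 0 ≤ q n) → (∀ n, 0 ≤ g n) →
    S.Admissible g (φ q g) ∧
    ∀ d : Decision N, S.Admissible g d → S.weight q g d ≤ S.weight q g (φ q g)

/-- `ν` is a possible law of the vector of channel gains of one slot: gains are nonnegative and
all service rates that can be offered are bounded by a constant `μmax`. -/
def IsChannelLaw (S : HMSystem) (ν : Measure (Fin N → ℝ)) : Prop :=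
  IsProbabilityMeasure ν ∧ (∀ᵐ g ∂ν, ∀ n, 0 ≤ g n) ∧
  ∃ μmax : ℝ, ∀ᵐ g ∂ν, ∀ d : Decision N, S.Admissible g d → ∀ k, S.service g d k ≤ μmax

/-- `h` and `a` are the channel-gain and arrival processes of a network with channel law `ν` and
vector of arrival rates `lam`: the gains are i.i.d. over slots with law `ν`, the arrivals are
i.i.d. over slots, bounded, with mean `lam`, and the two processes are independent. -/
structure IsNetwork {Ω : Type*} [MeasurableSpace Ω] (Pr : Measure Ω) (ν : Measure (Fin N → ℝ))
    (lam : Fin N → ℝ) (h a : ℕ → Ω → Fin N → ℝ) : Prop where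
  prob : IsProbabilityMeasure Pr
  meas_gain : ∀ t, Measurable (h t)
  meas_arrival : ∀ t, Measurable (a t)
  law_gain : ∀ t, Pr.map (h t) = ν
  indep_gain : iIndepFun h Pr
  identDistrib_arrival : ∀ t, IdentDistrib (a t) (a 0) Pr Pr
  indep_arrival : iIndepFun a Pr
  indep_gain_arrival : IndepFun (fun ω t => h t ω) (fun ω t => a t ω) Pr
  bounded_arrival : ∃ amax : ℝ, ∀ t, ∀ᵐ ω ∂Pr, ∀ n, 0 ≤ a t ω n ∧ a t ω n ≤ amax
  mean_arrival : ∀ t n, ∫ ω, a t ω n ∂Pr = lam n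

/-- Strong stability: for each user the limsup of the time averages of the expected queue length
is finite. -/
def StronglyStable {Ω : Type*} [MeasurableSpace Ω] (Pr : Measure Ω) (Q : ℕ → Ω → Fin N → ℝ) :
    Prop :=
  ∀ n, limsup (fun T : ℕ =>
    (∑ t ∈ Finset.range T, ∫⁻ ω, ENNReal.ofReal (Q t ω n) ∂Pr) / (T : ℝ≥0∞)) atTop < ⊤

/-- The first slot `t ≥ 1` at which the total queue length is at most `R` (`⊤` if none). -/
def returnTime {Ω : Type*} (Q : ℕ → Ω → Fin N → ℝ) (R : ℝ) (ω : Ω) : ℝ≥0∞ :=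
  ⨅ t ∈ {t : ℕ | 1 ≤ t ∧ ∑ n, Q t ω n ≤ R}, (t : ℝ≥0∞)

/-- The rule `φ` stabilizes the network, whatever the initial queues are. -/
def RuleStabilizes {Ω : Type*} [MeasurableSpace Ω] (S : HMSystem) (Pr : Measure Ω)
    (h a : ℕ → Ω → Fin N → ℝ) (φ : (Fin N → ℝ) → (Fin N → ℝ) → Decision N) : Prop :=
  ∀ q0 : Fin N → ℝ, (∀ n, 0 ≤ q0 n) →
    StronglyStable Pr (fun t ω => S.ruleQueue φ q0 (fun s => h s ω) (fun s => a s ω) t)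

/-- Positive recurrence of the queue process under the rule `φ`: there is a bounded set
`{q | ∑ q_n ≤ R}` to which the process returns in finite mean time from every initial state,
uniformly over bounded sets of initial states. -/
def RulePositiveRecurrent {Ω : Type*} [MeasurableSpace Ω] (S : HMSystem) (Pr : Measure Ω)
    (h a : ℕ → Ω → Fin N → ℝ) (φ : (Fin N → ℝ) → (Fin N → ℝ) → Decision N) : Prop :=
  ∃ R : ℝ, ∀ b : ℝ, ∃ K : ℝ, ∀ q0 : Fin N → ℝ, (∀ n, 0 ≤ q0 n) → ∑ n, q0 n ≤ b →
    ∫⁻ ω, returnTime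
      (fun t ω => S.ruleQueue φ q0 (fun s => h s ω) (fun s => a s ω) t) R ω ∂Pr
      ≤ ENNReal.ofReal K

/-- Information available to a scheduler in slot `t`: a random seed `U`, the gains up to and
including slot `t`, and the arrivals before slot `t`. -/
@[reducible] def history {Ω : Type*} (U : Ω → ℝ) (h a : ℕ → Ω → Fin N → ℝ) (t : ℕ) : MeasurableSpace Ω :=
  MeasurableSpace.comap U inferInstance ⊔
  (⨆ s ∈ Set.Iic t, MeasurableSpace.comap (h s) inferInstance) ⊔
  (⨆ s ∈ Set.Iio t, MeasurableSpace.comap (a s) inferInstance)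

/-- `d` is a scheduling policy: causal, possibly randomized by a seed `U` that is independent of
the network, possibly dependent on the whole past, and admissible in every slot. -/
structure IsPolicy {Ω : Type*} [MeasurableSpace Ω] (S : HMSystem) (Pr : Measure Ω)
    (h a : ℕ → Ω → Fin N → ℝ) (U : Ω → ℝ) (d : ℕ → Ω → Decision N) : Prop where
  meas_seed : Measurable U
  indep_seed : IndepFun U (fun ω => ((fun t => h t ω), (fun t => a t ω))) Pr
  causal : ∀ t, Measurable[history U h a t] (d t)
  admissible : ∀ᵐ ω ∂Pr, ∀ t, S.Admissible (h t ω) (d t ω)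

/-- `lam` is the vector of arrival rates of a network, with channel law `ν`, that some scheduling
policy stabilizes. -/
def Stabilizable (S : HMSystem) (ν : Measure (Fin N → ℝ)) (lam : Fin N → ℝ) : Prop :=
  ∃ (Ω : Type) (_ : MeasurableSpace Ω) (Pr : Measure Ω) (h a : ℕ → Ω → Fin N → ℝ)
    (U : Ω → ℝ) (d : ℕ → Ω → Decision N) (q0 : Fin N → ℝ),
    IsNetwork Pr ν lam h a ∧ S.IsPolicy Pr h a U d ∧ (∀ n, 0 ≤ q0 n) ∧
    StronglyStable Pr
      (fun t ω => S.queue q0 (fun s => h s ω) (fun s => a s ω) (fun s => d s ω) t)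

/-- The achievable rate region: the closure of the set of all vectors of arrival rates for which
there is a stabilizing scheduling policy. -/
def rateRegion (S : HMSystem) (ν : Measure (Fin N → ℝ)) : Set (Fin N → ℝ) :=
  closure {lam | S.Stabilizable ν lam}

/-- The rate region achieved by the rule `φ`: the closure of the set of all vectors of arrival
rates such that `φ` stabilizes every network with these rates. -/
def ruleRegion (S : HMSystem) (ν : Measure (Fin N → ℝ))
    (φ : (Fin N → ℝ) → (Fin N → ℝ) → Decision N) : Set (Fin N → ℝ) :=
  closure {lam | (∀ n, 0 ≤ lam n) ∧
    ∀ (Ω : Type) (_ : MeasurableSpace Ω) (Pr : Measure Ω) (h a : ℕ → Ω → Fin N → ℝ),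
      IsNetwork Pr ν lam h a → S.RuleStabilizes Pr h a φ}

end HMSystem

end

/-!
Max-Weight is throughput optimal because of one function of nonnegative weight vectors, the
expected maximal weight `meanMaxWeight w = E[max_d ∑ n, w n * μ_n(h, d)]`, which bounds what any
policy can do and which Max-Weight attains with `w` the current queues.

*Outer bound.* No policy, causal or not, offers more weighted service in a slot than the maximal
weight. If `∑ n, w n * lam n > meanMaxWeight w` for some `w ≥ 0`, the weighted mean queues therefore
grow at least linearly and their time averages diverge. So every stabilizable `lam`, and by
closedness every `lam` in the rate region, satisfies `∑ n, w n * lam n ≤ meanMaxWeight w` for all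
`w ≥ 0` (`sum_le_meanMaxWeight_of_mem_rateRegion`). These inequalities are all that is needed about
the region: no stationary randomized policy and no separation argument enters.

*Drift.* If the inequalities hold for `lam + ε` (`HasSlack`), inserting the current queues for `w`
shows that the Lyapunov function `∑ n, q n ^ 2` has conditional drift at most
`B - 2 * ∑ n, ε n * q n` under Max-Weight (`IsNetwork.drift`). The drift is stated in integrated
form, localized by a nonnegative factor that depends on the past only. The factor `1` gives strong
stability by telescoping (`IsNetwork.limsup_lt_top_of_slack`), the indicator of not having returned
to `{q | ∑ n, q n ≤ R}` gives the bound on the mean return time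
(`IsNetwork.positiveRecurrent_of_slack`).

*Equality of the regions.* If `lam` is stabilizable, `(1 - δ) • lam` has slack for all users that
can be served at all, while the remaining users have rate `0` and their queues never grow. Hence
Max-Weight stabilizes `(1 - δ) • lam`, and `δ → 0` gives one inclusion. For the other, constant
arrivals form a network with any given nonnegative rates (`stabilizable_of_rule`).
-/

noncomputable section

namespace HMSystem

variable {N : ℕ}

/-! ### Service rates and queue recursion -/

lemma baseRate_nonneg (S : HMSystem) {x p : ℝ} (hx : 0 ≤ x) (hp : 0 ≤ p) (hpP : p ≤ S.P) :
    0 ≤ S.baseRate x p := by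
  have h1 := S.Ts_pos
  have h2 := S.BW_pos
  have h3 := S.noise_pos
  have h4 : 0 ≤ S.P - p := sub_nonneg.2 hpP
  refine mul_nonneg (by positivity) (Real.log_nonneg ?_)
  have : 0 ≤ x * (S.P - p) / (x * p + S.noise) := by positivity
  linarith

lemma incRate_nonneg (S : HMSystem) {x p : ℝ} (hx : 0 ≤ x) (hp : 0 ≤ p) :
    0 ≤ S.incRate x p := by
  have h1 := S.Ts_pos
  have h2 := S.BW_pos
  have h3 := S.noise_pos
  refine mul_nonneg (by positivity) (Real.log_nonneg ?_)
  have : 0 ≤ x * p / S.noise := by positivity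
  linarith

lemma service_nonneg (S : HMSystem) {g : Fin N → ℝ} {d : Decision N} (hg : ∀ n, 0 ≤ g n)
    (hd : S.Admissible g d) (k : Fin N) : 0 ≤ S.service g d k := by
  obtain ⟨-, -, h0, hP⟩ := hd
  unfold service
  split_ifs
  · exact S.baseRate_nonneg (hg k) h0 hP
  · exact S.incRate_nonneg (hg k) h0
  · exact le_rfl

lemma weight_eq_sum (S : HMSystem) (q g : Fin N → ℝ) {d : Decision N} (hd : S.Admissible g d) :
    S.weight q g d = ∑ k, q k * S.service g d k := by
  have hne : d.1 ≠ d.2.1 := hd.1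
  rw [Fintype.sum_eq_add d.1 d.2.1 hne]
  · simp [weight, service, hne.symm]
  · rintro k ⟨h1, h2⟩
    simp [service, h1, h2]

lemma measurable_service (S : HMSystem) (k : Fin N) :
    Measurable fun x : (Fin N → ℝ) × Decision N => S.service x.1 x.2 k := by
  unfold service baseRate incRate
  refine Measurable.ite ?_ (by fun_prop) (Measurable.ite ?_ (by fun_prop) measurable_const)
  · have : Measurable fun x : (Fin N → ℝ) × Decision N => x.2.1 := by fun_prop
    exact measurableSet_eq_fun measurable_const this
  · have : Measurable fun x : (Fin N → ℝ) × Decision N => x.2.2.1 := by fun_prop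
    exact measurableSet_eq_fun measurable_const this

lemma measurable_step {Ω : Type*} {m : MeasurableSpace Ω} (S : HMSystem)
    {q g a : Ω → Fin N → ℝ} {d : Ω → Decision N} (hq : Measurable q) (hg : Measurable g)
    (ha : Measurable a) (hd : Measurable d) :
    Measurable fun ω => S.step (q ω) (g ω) (a ω) (d ω) := by
  refine measurable_pi_lambda _ fun k => ?_
  have hs : Measurable fun ω => S.service (g ω) (d ω) k :=
    (S.measurable_service k).comp (hg.prodMk hd)
  unfold step
  fun_prop

lemma step_nonneg (S : HMSystem) (q g a : Fin N → ℝ) (d : Decision N) (k : Fin N) :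
    0 ≤ S.step q g a d k := le_max_right _ _

lemma le_step (S : HMSystem) (q g a : Fin N → ℝ) (d : Decision N) (k : Fin N) :
    q k + a k - S.service g d k ≤ S.step q g a d k := le_max_left _ _

lemma step_le (S : HMSystem) {q g a : Fin N → ℝ} {d : Decision N} {k : Fin N}
    (hq : 0 ≤ q k) (ha : 0 ≤ a k) (hs : 0 ≤ S.service g d k) :
    S.step q g a d k ≤ q k + a k :=
  max_le (by linarith) (by linarith)

/-- The one-step bound on the square of a queue, from `max x 0 ^ 2 ≤ x ^ 2`. -/
lemma step_sq_le (S : HMSystem) {q g a : Fin N → ℝ} {d : Decision N} {k : Fin N} {A M : ℝ}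
    (ha : 0 ≤ a k) (haA : a k ≤ A) (hs : 0 ≤ S.service g d k) (hsM : S.service g d k ≤ M) :
    S.step q g a d k ^ 2 ≤
      q k ^ 2 + 2 * (q k * a k) - 2 * (q k * S.service g d k) + (A ^ 2 + M ^ 2) := by
  have h1 : S.step q g a d k ^ 2 ≤ (q k + a k - S.service g d k) ^ 2 := by
    unfold step
    rcases le_total (q k + a k - S.service g d k) 0 with h | h
    · rw [max_eq_right h, zero_pow two_ne_zero]; positivity
    · rw [max_eq_left h]
  nlinarith [mul_nonneg ha hs]

lemma measurable_queue {Ω : Type*} {m : MeasurableSpace Ω} (S : HMSystem) (q0 : Fin N → ℝ)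
    {g a : ℕ → Ω → Fin N → ℝ} {d : ℕ → Ω → Decision N} (hg : ∀ t, Measurable (g t))
    (ha : ∀ t, Measurable (a t)) (hd : ∀ t, Measurable (d t)) (t : ℕ) :
    Measurable fun ω => S.queue q0 (fun s => g s ω) (fun s => a s ω) (fun s => d s ω) t := by
  induction t with
  | zero => exact measurable_const
  | succ t ih => exact S.measurable_step ih (hg t) (ha t) (hd t)

lemma measurable_rule {Ω : Type*} {m : MeasurableSpace Ω}
    {φ : (Fin N → ℝ) → (Fin N → ℝ) → Decision N} (hφ : Measurable (Function.uncurry φ))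
    {q g : Ω → Fin N → ℝ} (hq : Measurable q) (hg : Measurable g) :
    Measurable fun ω => φ (q ω) (g ω) := hφ.comp (hq.prodMk hg)

/-- The queues in slot `t` are a function of the gains and arrivals before slot `t`. -/
lemma measurable_ruleQueue {Ω : Type*} {m : MeasurableSpace Ω} (S : HMSystem)
    {φ : (Fin N → ℝ) → (Fin N → ℝ) → Decision N} (hφ : Measurable (Function.uncurry φ))
    (q0 : Fin N → ℝ) {g a : ℕ → Ω → Fin N → ℝ} (t : ℕ) (hg : ∀ s < t, Measurable (g s))
    (ha : ∀ s < t, Measurable (a s)) :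
    Measurable fun ω => S.ruleQueue φ q0 (fun s => g s ω) (fun s => a s ω) t := by
  induction t with
  | zero => exact measurable_const
  | succ t ih =>
    have hq := ih (fun s hs => hg s (by omega)) fun s hs => ha s (by omega)
    exact S.measurable_step hq (hg t (by omega)) (ha t (by omega))
      (measurable_rule hφ hq (hg t (by omega)))

lemma ruleQueue_eq_queue (S : HMSystem) (φ : (Fin N → ℝ) → (Fin N → ℝ) → Decision N)
    (q0 : Fin N → ℝ) (g a : ℕ → Fin N → ℝ) (t : ℕ) :
    S.ruleQueue φ q0 g a t =
      S.queue q0 g a (fun s => φ (S.ruleQueue φ q0 g a s) (g s)) t := by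
  induction t with
  | zero => rfl
  | succ t ih =>
    simp only [ruleQueue, queue]
    rw [← ih]

lemma ruleQueue_nonneg (S : HMSystem) (φ : (Fin N → ℝ) → (Fin N → ℝ) → Decision N)
    {q0 : Fin N → ℝ} (hq0 : ∀ n, 0 ≤ q0 n) (g a : ℕ → Fin N → ℝ) (t : ℕ) (n : Fin N) :
    0 ≤ S.ruleQueue φ q0 g a t n := by
  cases t with
  | zero => exact hq0 n
  | succ t => exact S.step_nonneg _ _ _ _ _

/-- If the arrivals are at most `A` per slot, the queues grow at most linearly. -/
lemma ruleQueue_le (S : HMSystem) {φ : (Fin N → ℝ) → (Fin N → ℝ) → Decision N}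
    (hφ : S.IsMWHM φ) {q0 : Fin N → ℝ} (hq0 : ∀ n, 0 ≤ q0 n) {g a : ℕ → Fin N → ℝ} {A : ℝ}
    (hg : ∀ t n, 0 ≤ g t n) (ha : ∀ t n, 0 ≤ a t n ∧ a t n ≤ A) (t : ℕ) (n : Fin N) :
    S.ruleQueue φ q0 g a t n ≤ q0 n + t * A := by
  induction t with
  | zero => simp [ruleQueue]
  | succ t ih =>
    have hq := S.ruleQueue_nonneg φ hq0 g a t
    have h1 : S.ruleQueue φ q0 g a (t + 1) n ≤ S.ruleQueue φ q0 g a t n + a t n :=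
      S.step_le (hq n) (ha t n).1
        (S.service_nonneg (hg t) (hφ.2 _ _ hq (hg t)).1 n)
    push_cast
    linarith [(ha t n).2]

/-! ### The expected maximal weight -/

/-- The expected maximal weight `E[max_d ∑ k, w k * μ_k(h, d)]` of a slot whose gains have law
`ν`, written through the maximizer `φ`. -/
def meanMaxWeight (S : HMSystem) (ν : Measure (Fin N → ℝ))
    (φ : (Fin N → ℝ) → (Fin N → ℝ) → Decision N) (w : Fin N → ℝ) : ℝ :=
  ∫ g, ∑ k, w k * S.service g (φ w g) k ∂ν

lemma measurable_ruleService (S : HMSystem) {φ : (Fin N → ℝ) → (Fin N → ℝ) → Decision N}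
    (hφ : Measurable (Function.uncurry φ)) (k : Fin N) :
    Measurable fun x : (Fin N → ℝ) × (Fin N → ℝ) => S.service x.2 (φ x.1 x.2) k :=
  (S.measurable_service k).comp (measurable_snd.prodMk hφ)

lemma IsChannelLaw.exists_service_bound {S : HMSystem} {ν : Measure (Fin N → ℝ)}
    (hν : S.IsChannelLaw ν) : ∃ M : ℝ, ∀ᵐ g ∂ν, (∀ n, 0 ≤ g n) ∧
      ∀ d : Decision N, S.Admissible g d → ∀ k, 0 ≤ S.service g d k ∧ S.service g d k ≤ M := by
  obtain ⟨-, h0, M, hM⟩ := hν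
  refine ⟨M, ?_⟩
  filter_upwards [h0, hM] with g hg hgM
  exact ⟨hg, fun d hd k => ⟨S.service_nonneg hg hd k, hgM d hd k⟩⟩

lemma integrable_maxWeight {S : HMSystem} {ν : Measure (Fin N → ℝ)} (hν : S.IsChannelLaw ν)
    {φ : (Fin N → ℝ) → (Fin N → ℝ) → Decision N} (hφ : S.IsMWHM φ) {w : Fin N → ℝ}
    (hw : ∀ n, 0 ≤ w n) : Integrable (fun g => ∑ k, w k * S.service g (φ w g) k) ν := by
  have := hν.1
  obtain ⟨M, hM⟩ := hν.exists_service_bound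
  refine integrable_finsetSum _ fun k _ => Integrable.const_mul ?_ _
  refine Integrable.of_mem_Icc 0 M ?_ ?_
  · exact ((S.measurable_ruleService hφ.1 k).comp
      (measurable_const.prodMk measurable_id)).aemeasurable
  · filter_upwards [hM] with g hg
    exact hg.2 _ (hφ.2 w g hw hg.1).1 k

lemma single_one_nonneg (n k : Fin N) : (0 : ℝ) ≤ (Pi.single n 1 : Fin N → ℝ) k := by
  rw [Pi.single_apply]
  split_ifs <;> norm_num

/-- Serving as if user `n` were the only one is no better than the maximal weight. -/
lemma le_meanMaxWeight {S : HMSystem} {ν : Measure (Fin N → ℝ)} (hν : S.IsChannelLaw ν)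
    {φ : (Fin N → ℝ) → (Fin N → ℝ) → Decision N} (hφ : S.IsMWHM φ) {w : Fin N → ℝ}
    (hw : ∀ n, 0 ≤ w n) (n : Fin N) :
    w n * S.meanMaxWeight ν φ (Pi.single n 1) ≤ S.meanMaxWeight ν φ w := by
  have h1 := single_one_nonneg n
  unfold meanMaxWeight
  rw [← integral_const_mul]
  refine integral_mono_ae ((integrable_maxWeight hν hφ h1).const_mul _)
    (integrable_maxWeight hν hφ hw) ?_
  filter_upwards [hν.2.1] with g hg
  have ha := (hφ.2 (Pi.single n 1) g h1 hg).1
  have hb := (hφ.2 w g hw hg)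
  have hc := hb.2 _ ha
  rw [S.weight_eq_sum _ _ ha, S.weight_eq_sum _ _ hb.1] at hc
  have single_sum : ∀ f : Fin N → ℝ, ∑ k, (Pi.single n 1 : Fin N → ℝ) k * f k = f n := fun f => by
    simp [Pi.single_apply]
  rw [single_sum]
  exact (Finset.single_le_sum (f := fun k => w k * S.service g (φ (Pi.single n 1) g) k)
    (fun k _ => mul_nonneg (hw k) (S.service_nonneg hg ha k)) (Finset.mem_univ n)).trans hc

lemma meanMaxWeight_nonneg {S : HMSystem} {ν : Measure (Fin N → ℝ)} (hν : S.IsChannelLaw ν)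
    {φ : (Fin N → ℝ) → (Fin N → ℝ) → Decision N} (hφ : S.IsMWHM φ) {w : Fin N → ℝ}
    (hw : ∀ n, 0 ≤ w n) : 0 ≤ S.meanMaxWeight ν φ w := by
  refine integral_nonneg_of_ae ?_
  filter_upwards [hν.2.1] with g hg
  exact Finset.sum_nonneg fun k _ =>
    mul_nonneg (hw k) (S.service_nonneg hg (hφ.2 w g hw hg).1 k)

/-! ### Independence of the past -/

/-- Two independent families that are independent of each other form one independent family. -/
lemma iIndepFun_sumElim {Ω ι κ E : Type*} [MeasurableSpace Ω] [MeasurableSpace E] {μ : Measure Ω}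
    {X : ι → Ω → E} {Y : κ → Ω → E} (hX : iIndepFun X μ) (hY : iIndepFun Y μ)
    (hXY : IndepFun (fun ω i => X i ω) (fun ω j => Y j ω) μ) : iIndepFun (Sum.elim X Y) μ := by
  classical
  rw [iIndepFun_iff_measure_inter_preimage_eq_mul]
  intro s B hB
  have hs : s = s.toLeft.disjSum s.toRight := Finset.toLeft_disjSum_toRight.symm
  have h1 : (⋂ i ∈ s, Sum.elim X Y i ⁻¹' B i) =
      ((fun ω i => X i ω) ⁻¹' (⋂ i ∈ s.toLeft, Function.eval i ⁻¹' B (Sum.inl i))) ∩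
      ((fun ω i => Y i ω) ⁻¹' (⋂ i ∈ s.toRight, Function.eval i ⁻¹' B (Sum.inr i))) := by
    ext ω
    simp only [Set.mem_iInter, Set.mem_preimage, Set.mem_inter_iff, Finset.mem_toLeft,
      Finset.mem_toRight, Sum.forall, Sum.elim_inl, Sum.elim_inr, Function.eval]
  rw [h1, (indepFun_iff_measure_inter_preimage_eq_mul.1 hXY) _ _
    (Finset.measurableSet_biInter _ fun i hi => measurable_pi_apply i (hB _ (by simpa using hi)))
    (Finset.measurableSet_biInter _ fun i hi => measurable_pi_apply i (hB _ (by simpa using hi)))]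
  conv_rhs => rw [hs, Finset.prod_disjSum]
  congr 1
  · refine Eq.trans ?_ ((iIndepFun_iff_measure_inter_preimage_eq_mul.1 hX) s.toLeft
      (sets := fun i => B (Sum.inl i)) fun i hi => hB _ (by simpa using hi))
    simp only [Set.preimage_iInter]; rfl
  · refine Eq.trans ?_ ((iIndepFun_iff_measure_inter_preimage_eq_mul.1 hY) s.toRight
      (sets := fun i => B (Sum.inr i)) fun i hi => hB _ (by simpa using hi))
    simp only [Set.preimage_iInter]; rfl

/-- The σ-algebra generated by the gains and arrivals before slot `t`. Gains and arrivals are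
joined into one family over `ℕ ⊕ ℕ`, so that independence of disjoint index sets applies. -/
@[reducible] def past {Ω : Type*} (h a : ℕ → Ω → Fin N → ℝ) (t : ℕ) : MeasurableSpace Ω :=
  ⨆ i ∈ Sum.elim (fun s => s) (fun s => s) ⁻¹' Set.Iio t,
    MeasurableSpace.comap (Sum.elim h a i) inferInstance

lemma past_mono {Ω : Type*} (h a : ℕ → Ω → Fin N → ℝ) {s t : ℕ} (hst : s ≤ t) :
    past h a s ≤ past h a t :=
  biSup_mono fun _ hi => lt_of_lt_of_le hi hst

lemma measurable_past_gain {Ω : Type*} (h a : ℕ → Ω → Fin N → ℝ) {s t : ℕ} (hst : s < t) :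
    Measurable[past h a t] (h s) :=
  Measurable.of_comap_le (le_iSup₂_of_le (f := fun i _ => MeasurableSpace.comap (Sum.elim h a i)
    inferInstance) (Sum.inl s) hst le_rfl)

lemma measurable_past_arrival {Ω : Type*} (h a : ℕ → Ω → Fin N → ℝ) {s t : ℕ} (hst : s < t) :
    Measurable[past h a t] (a s) :=
  Measurable.of_comap_le (le_iSup₂_of_le (f := fun i _ => MeasurableSpace.comap (Sum.elim h a i)
    inferInstance) (Sum.inr s) hst le_rfl)

namespace IsNetwork

variable {Ω : Type*} [mΩ : MeasurableSpace Ω] {Pr : Measure Ω} {ν : Measure (Fin N → ℝ)}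
  {lam : Fin N → ℝ} {h a : ℕ → Ω → Fin N → ℝ}

lemma measurable_sumElim (net : IsNetwork Pr ν lam h a) (i : ℕ ⊕ ℕ) :
    Measurable (Sum.elim h a i) := by
  cases i with
  | inl s => exact net.meas_gain s
  | inr s => exact net.meas_arrival s

lemma past_le (net : IsNetwork Pr ν lam h a) (t : ℕ) : past h a t ≤ mΩ :=
  iSup₂_le fun i _ => (net.measurable_sumElim i).comap_le

lemma indep_past (net : IsNetwork Pr ν lam h a) {t : ℕ} (i : ℕ ⊕ ℕ)
    (hi : t ≤ Sum.elim (fun s => s) (fun s => s) i) {E : Type*} [MeasurableSpace E] {Z : Ω → E}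
    (hZ : Measurable[past h a t] Z) : IndepFun Z (Sum.elim h a i) Pr := by
  have hind := iIndepFun_sumElim net.indep_gain net.indep_arrival net.indep_gain_arrival
  have h1 := indep_iSup_of_disjoint (fun j => (net.measurable_sumElim j).comap_le) hind.iIndep
    (S := Sum.elim (fun s => s) (fun s => s) ⁻¹' Set.Iio t) (T := {i})
    (Set.disjoint_singleton_right.2 fun hlt => absurd (Set.mem_Iio.1 hlt) (not_lt.2 hi))
  rw [IndepFun_iff_Indep]
  exact indep_of_indep_of_le h1 hZ.comap_le (by simp)

lemma indep_past_gain (net : IsNetwork Pr ν lam h a) (t : ℕ) {E : Type*} [MeasurableSpace E]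
    {Z : Ω → E} (hZ : Measurable[past h a t] Z) : IndepFun Z (h t) Pr :=
  net.indep_past (Sum.inl t) le_rfl hZ

lemma indep_past_arrival (net : IsNetwork Pr ν lam h a) (t : ℕ) {E : Type*} [MeasurableSpace E]
    {Z : Ω → E} (hZ : Measurable[past h a t] Z) : IndepFun Z (a t) Pr :=
  net.indep_past (Sum.inr t) le_rfl hZ

/-- The bounds on gains, arrivals and offered services hold in all slots at once, almost surely. -/
lemma ae_bounds {S : HMSystem} (net : IsNetwork Pr ν lam h a) (hν : S.IsChannelLaw ν) :
    ∃ A M : ℝ, ∀ᵐ ω ∂Pr, ∀ t, (∀ n, 0 ≤ a t ω n ∧ a t ω n ≤ A) ∧ (∀ n, 0 ≤ h t ω n) ∧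
      ∀ d : Decision N, S.Admissible (h t ω) d →
        ∀ k, 0 ≤ S.service (h t ω) d k ∧ S.service (h t ω) d k ≤ M := by
  obtain ⟨A, hA⟩ := net.bounded_arrival
  obtain ⟨M, hM⟩ := hν.exists_service_bound
  refine ⟨A, M, ae_all_iff.2 fun t => ?_⟩
  have hM' := hM
  rw [← net.law_gain t] at hM'
  filter_upwards [hA t, ae_of_ae_map (net.meas_gain t).aemeasurable hM'] with ω h1 h2
  exact ⟨h1, h2⟩

end IsNetwork

/-! ### Lyapunov drift -/

/-- Fubini for independent variables: averaging over `Y` with `Z` frozen. -/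
lemma integral_comp_indep {Ω E E' : Type*} [MeasurableSpace Ω] [MeasurableSpace E]
    [MeasurableSpace E'] {Pr : Measure Ω} [IsProbabilityMeasure Pr] {Z : Ω → E} {Y : Ω → E'}
    {ν : Measure E'} (hZ : Measurable Z) (hY : Measurable Y) (hν : Pr.map Y = ν)
    (hZY : IndepFun Z Y Pr) {F : E → E' → ℝ} (hF : Measurable (Function.uncurry F))
    (hint : Integrable (fun ω => F (Z ω) (Y ω)) Pr) :
    Integrable (fun ω => ∫ y, F (Z ω) y ∂ν) Pr ∧
      ∫ ω, F (Z ω) (Y ω) ∂Pr = ∫ ω, ∫ y, F (Z ω) y ∂ν ∂Pr := by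
  have h1 : Pr.map (fun ω => (Z ω, Y ω)) = (Pr.map Z).prod ν := by
    rw [← hν]
    exact (indepFun_iff_map_prod_eq_prod_map_map hZ.aemeasurable hY.aemeasurable).1 hZY
  have hprobZ : IsProbabilityMeasure (Pr.map Z) := Measure.isProbabilityMeasure_map hZ.aemeasurable
  have hprobν : IsProbabilityMeasure ν := hν ▸ Measure.isProbabilityMeasure_map hY.aemeasurable
  have h2 : Integrable (Function.uncurry F) ((Pr.map Z).prod ν) := by
    rw [← h1]
    exact (integrable_map_measure hF.aestronglyMeasurable (hZ.prodMk hY).aemeasurable).2 hint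
  have h3 := h2.integral_prod_left
  refine ⟨h3.comp_aemeasurable hZ.aemeasurable, ?_⟩
  calc ∫ ω, F (Z ω) (Y ω) ∂Pr
      = ∫ z, Function.uncurry F z ∂(Pr.map (fun ω => (Z ω, Y ω))) :=
        (integral_map (hZ.prodMk hY).aemeasurable hF.aestronglyMeasurable).symm
    _ = ∫ z, ∫ y, F z y ∂ν ∂(Pr.map Z) := by
        rw [h1, integral_prod _ h2]; rfl
    _ = ∫ ω, ∫ y, F (Z ω) y ∂ν ∂Pr :=
        integral_map hZ.aemeasurable h3.aestronglyMeasurable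

/-- The queues of a network under the rule `φ`, as random vectors. -/
def randomQueue {Ω : Type*} (S : HMSystem) (φ : (Fin N → ℝ) → (Fin N → ℝ) → Decision N)
    (q0 : Fin N → ℝ) (h a : ℕ → Ω → Fin N → ℝ) (t : ℕ) (ω : Ω) : Fin N → ℝ :=
  S.ruleQueue φ q0 (fun s => h s ω) (fun s => a s ω) t

/-- `lam` lies in the region dominated by the expected maximal weight, with slack `ε n` for
user `n`. -/
def HasSlack (S : HMSystem) (ν : Measure (Fin N → ℝ))
    (φ : (Fin N → ℝ) → (Fin N → ℝ) → Decision N) (lam ε : Fin N → ℝ) : Prop :=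
  ∀ w : Fin N → ℝ, (∀ n, 0 ≤ w n) → ∑ n, w n * (lam n + ε n) ≤ S.meanMaxWeight ν φ w

lemma measurable_past_randomQueue {Ω : Type*} {h a : ℕ → Ω → Fin N → ℝ} {S : HMSystem}
    {φ : (Fin N → ℝ) → (Fin N → ℝ) → Decision N} (hφ : S.IsMWHM φ) (q0 : Fin N → ℝ) (t : ℕ) :
    Measurable[past h a t] (S.randomQueue φ q0 h a t) :=
  S.measurable_ruleQueue (m := past h a t) hφ.1 q0 t (fun _ hs => measurable_past_gain h a hs)
    fun _ hs => measurable_past_arrival h a hs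

namespace IsNetwork

variable {Ω : Type*} [mΩ : MeasurableSpace Ω] {Pr : Measure Ω} {ν : Measure (Fin N → ℝ)}
  {lam : Fin N → ℝ} {h a : ℕ → Ω → Fin N → ℝ} {S : HMSystem}
  {φ : (Fin N → ℝ) → (Fin N → ℝ) → Decision N}

lemma measurable_randomQueue (net : IsNetwork Pr ν lam h a) (hφ : S.IsMWHM φ)
    (q0 : Fin N → ℝ) (t : ℕ) : Measurable (S.randomQueue φ q0 h a t) :=
  (measurable_past_randomQueue hφ q0 t).mono (net.past_le t) le_rfl

lemma exists_randomQueue_bound (net : IsNetwork Pr ν lam h a) (hν : S.IsChannelLaw ν)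
    (hφ : S.IsMWHM φ) {q0 : Fin N → ℝ} (hq0 : ∀ n, 0 ≤ q0 n) (t : ℕ) :
    ∃ C : ℝ, ∀ᵐ ω ∂Pr, ∀ n, 0 ≤ S.randomQueue φ q0 h a t ω n ∧
      S.randomQueue φ q0 h a t ω n ≤ C := by
  obtain ⟨A, M, hAM⟩ := net.ae_bounds hν
  refine ⟨∑ k, q0 k + t * A, ?_⟩
  filter_upwards [hAM] with ω hω n
  refine ⟨S.ruleQueue_nonneg φ hq0 _ _ t n, ?_⟩
  have h1 := S.ruleQueue_le hφ hq0 (fun s => (hω s).2.1) (fun s => (hω s).1) t n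
  have h2 := Finset.single_le_sum (f := q0) (fun k _ => hq0 k) (Finset.mem_univ n)
  exact h1.trans (by linarith)

lemma integrable_mul_randomQueue (net : IsNetwork Pr ν lam h a) (hν : S.IsChannelLaw ν)
    (hφ : S.IsMWHM φ) {q0 : Fin N → ℝ} (hq0 : ∀ n, 0 ≤ q0 n) (t : ℕ) {f : Ω → ℝ}
    (hf : Integrable f Pr) (n : Fin N) :
    Integrable (fun ω => f ω * S.randomQueue φ q0 h a t ω n) Pr := by
  obtain ⟨C, hC⟩ := net.exists_randomQueue_bound hν hφ hq0 t
  refine hf.mul_bdd (c := C)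
    ((measurable_pi_apply n).comp
      (net.measurable_randomQueue hφ q0 t)).aestronglyMeasurable ?_
  filter_upwards [hC] with ω hω
  rw [Real.norm_eq_abs, abs_of_nonneg (hω n).1]
  exact (hω n).2

lemma integrable_mul_sq (net : IsNetwork Pr ν lam h a) (hν : S.IsChannelLaw ν)
    (hφ : S.IsMWHM φ) {q0 : Fin N → ℝ} (hq0 : ∀ n, 0 ≤ q0 n) (t : ℕ) {f : Ω → ℝ}
    (hf : Integrable f Pr) :
    Integrable (fun ω => f ω * ∑ n, S.randomQueue φ q0 h a t ω n ^ 2) Pr := by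
  simp only [Finset.mul_sum, pow_two, ← mul_assoc]
  exact integrable_finsetSum _ fun n _ => net.integrable_mul_randomQueue hν hφ hq0 t
    (net.integrable_mul_randomQueue hν hφ hq0 t hf n) n

/-- On events of the past, the service rates in the next slot may be averaged over the law of
the gains with the queues frozen. -/
lemma integral_mul_service (net : IsNetwork Pr ν lam h a) (hν : S.IsChannelLaw ν)
    (hφ : S.IsMWHM φ) {q0 : Fin N → ℝ} (hq0 : ∀ n, 0 ≤ q0 n) (t : ℕ) {χ : Ω → ℝ}
    (hχ : Measurable[past h a t] χ) (hχi : Integrable χ Pr) :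
    Integrable (fun ω => χ ω * ∑ n, S.randomQueue φ q0 h a t ω n *
      S.service (h t ω) (φ (S.randomQueue φ q0 h a t ω) (h t ω)) n) Pr ∧
    Integrable (fun ω => χ ω * S.meanMaxWeight ν φ (S.randomQueue φ q0 h a t ω)) Pr ∧
    ∫ ω, χ ω * ∑ n, S.randomQueue φ q0 h a t ω n *
      S.service (h t ω) (φ (S.randomQueue φ q0 h a t ω) (h t ω)) n ∂Pr =
    ∫ ω, χ ω * S.meanMaxWeight ν φ (S.randomQueue φ q0 h a t ω) ∂Pr := by
  have := net.prob
  have hQ := net.measurable_randomQueue hφ q0 t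
  have hint : Integrable (fun ω => χ ω * ∑ n, S.randomQueue φ q0 h a t ω n *
      S.service (h t ω) (φ (S.randomQueue φ q0 h a t ω) (h t ω)) n) Pr := by
    simp only [Finset.mul_sum, ← mul_assoc]
    refine integrable_finsetSum _ fun n _ => ?_
    obtain ⟨A, M, hAM⟩ := net.ae_bounds hν
    refine (net.integrable_mul_randomQueue hν hφ hq0 t hχi n).mul_bdd (c := M)
      ((S.measurable_ruleService hφ.1 n).comp
        (hQ.prodMk (net.meas_gain t))).aestronglyMeasurable ?_
    filter_upwards [hAM] with ω hω
    obtain ⟨h1, h2⟩ := (hω t).2.2 _ (hφ.2 (S.randomQueue φ q0 h a t ω) (h t ω)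
      (S.ruleQueue_nonneg φ hq0 _ _ t) (hω t).2.1).1 n
    simpa [abs_of_nonneg h1] using h2
  have hF : Measurable (Function.uncurry fun (z : (Fin N → ℝ) × ℝ) (g : Fin N → ℝ) =>
      z.2 * ∑ n, z.1 n * S.service g (φ z.1 g) n) := by
    have h1 : ∀ n, Measurable fun x : ((Fin N → ℝ) × ℝ) × (Fin N → ℝ) =>
        S.service x.2 (φ x.1.1 x.2) n := fun n =>
      (S.measurable_ruleService hφ.1 n).comp (by fun_prop : Measurable
        fun x : ((Fin N → ℝ) × ℝ) × (Fin N → ℝ) => (x.1.1, x.2))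
    unfold Function.uncurry
    fun_prop
  have hχm : Measurable χ := hχ.mono (net.past_le t) le_rfl
  obtain ⟨h1, h2⟩ := integral_comp_indep (hQ.prodMk hχm) (net.meas_gain t) (net.law_gain t)
    (net.indep_past_gain t ((measurable_past_randomQueue hφ q0 t).prodMk hχ)) hF hint
  simp only [integral_const_mul] at h1 h2
  exact ⟨hint, h1, h2⟩

/-- The drift of the Lyapunov function `∑ n, q n ^ 2` under Max-Weight, localized by a weight `χ`
that is determined by the past. -/
theorem drift (net : IsNetwork Pr ν lam h a) (hν : S.IsChannelLaw ν) (hφ : S.IsMWHM φ)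
    {ε : Fin N → ℝ} (hslack : S.HasSlack ν φ lam ε) :
    ∃ B : ℝ, 0 ≤ B ∧ ∀ q0 : Fin N → ℝ, (∀ n, 0 ≤ q0 n) → ∀ (t : ℕ) (χ : Ω → ℝ),
      Measurable[past h a t] χ → Integrable χ Pr → (∀ ω, 0 ≤ χ ω) →
      ∫ ω, χ ω * ∑ n, S.randomQueue φ q0 h a (t + 1) ω n ^ 2 ∂Pr +
        2 * ∫ ω, ∑ n, ε n * (χ ω * S.randomQueue φ q0 h a t ω n) ∂Pr ≤
      ∫ ω, χ ω * ∑ n, S.randomQueue φ q0 h a t ω n ^ 2 ∂Pr + B * ∫ ω, χ ω ∂Pr := by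
  have := net.prob
  obtain ⟨A, M, hAM⟩ := net.ae_bounds hν
  refine ⟨N * (A ^ 2 + M ^ 2), by positivity, fun q0 hq0 t χ hχ hχi hχ0 => ?_⟩
  set Q := S.randomQueue φ q0 h a with hQdef
  have hQ0 : ∀ t ω n, 0 ≤ Q t ω n := fun t ω n => S.ruleQueue_nonneg φ hq0 _ _ t n
  obtain ⟨hi1, hi2, heq⟩ := net.integral_mul_service hν hφ hq0 t hχ hχi
  rw [← hQdef] at hi1 hi2 heq
  have hiQ : ∀ n, Integrable (fun ω => χ ω * Q t ω n) Pr := fun n =>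
    net.integrable_mul_randomQueue hν hφ hq0 t hχi n
  have hiV := net.integrable_mul_sq hν hφ hq0 t hχi
  have hiV' := net.integrable_mul_sq hν hφ hq0 (t + 1) hχi
  rw [← hQdef] at hiV hiV'
  have hiA : ∀ n, Integrable (fun ω => χ ω * Q t ω n * a t ω n) Pr := fun n => by
    refine (hiQ n).mul_bdd (c := A)
      ((measurable_pi_apply n).comp (net.meas_arrival t)).aestronglyMeasurable ?_
    filter_upwards [hAM] with ω hω
    rw [Real.norm_eq_abs, abs_of_nonneg ((hω t).1 n).1]
    exact ((hω t).1 n).2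
  have hA : ∀ n, ∫ ω, χ ω * Q t ω n * a t ω n ∂Pr = lam n * ∫ ω, χ ω * Q t ω n ∂Pr := fun n => by
    have hZ : Measurable[past h a t] fun ω => χ ω * Q t ω n :=
      hχ.mul ((measurable_pi_apply n).comp (measurable_past_randomQueue hφ q0 t))
    have hind : IndepFun (fun ω => χ ω * Q t ω n) (fun ω => a t ω n) Pr :=
      (net.indep_past_arrival t hZ).comp measurable_id (measurable_pi_apply n)
    rw [← net.mean_arrival t n, mul_comm (∫ ω, a t ω n ∂Pr)]
    exact hind.integral_fun_mul_eq_mul_integral (hiQ n).aestronglyMeasurable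
      ((measurable_pi_apply n).comp (net.meas_arrival t)).aestronglyMeasurable
  have hi12 : Integrable (fun ω => χ ω * ∑ n, Q t ω n ^ 2
      + 2 * ∑ n, χ ω * Q t ω n * a t ω n) Pr :=
    hiV.add ((integrable_finsetSum _ fun n _ => hiA n).const_mul 2)
  have hi123 : Integrable (fun ω => χ ω * ∑ n, Q t ω n ^ 2 + 2 * ∑ n, χ ω * Q t ω n * a t ω n
      - 2 * (χ ω * ∑ n, Q t ω n * S.service (h t ω) (φ (Q t ω) (h t ω)) n)) Pr :=
    hi12.sub (hi1.const_mul 2)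
  -- the pointwise one-step bound, integrated
  have hstep : ∫ ω, χ ω * ∑ n, Q (t + 1) ω n ^ 2 ∂Pr ≤
      ∫ ω, (χ ω * ∑ n, Q t ω n ^ 2 + 2 * ∑ n, χ ω * Q t ω n * a t ω n
        - 2 * (χ ω * ∑ n, Q t ω n * S.service (h t ω) (φ (Q t ω) (h t ω)) n)
        + (N * (A ^ 2 + M ^ 2)) * χ ω) ∂Pr := by
    refine integral_mono_ae hiV' (hi123.add (hχi.const_mul _)) ?_
    filter_upwards [hAM] with ω hω
    have h1 : ∑ n, Q (t + 1) ω n ^ 2 ≤ ∑ n, (Q t ω n ^ 2 + 2 * (Q t ω n * a t ω n)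
        - 2 * (Q t ω n * S.service (h t ω) (φ (Q t ω) (h t ω)) n) + (A ^ 2 + M ^ 2)) := by
      refine Finset.sum_le_sum fun n _ => ?_
      obtain ⟨h1, h2⟩ := (hω t).2.2 _ (hφ.2 (Q t ω) (h t ω) (hQ0 t ω) (hω t).2.1).1 n
      exact S.step_sq_le ((hω t).1 n).1 ((hω t).1 n).2 h1 h2
    refine (mul_le_mul_of_nonneg_left h1 (hχ0 ω)).trans (le_of_eq ?_)
    simp only [Finset.sum_add_distrib, Finset.sum_sub_distrib, ← Finset.mul_sum, mul_assoc,
      Finset.sum_const, Finset.card_univ, Fintype.card_fin, nsmul_eq_mul]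
    ring
  rw [integral_add hi123 (hχi.const_mul _), integral_sub hi12 (hi1.const_mul 2),
    integral_add hiV ((integrable_finsetSum _ fun n _ => hiA n).const_mul 2),
    integral_const_mul, integral_const_mul, integral_const_mul, heq,
    integral_finsetSum _ fun n _ => hiA n] at hstep
  simp only [hA] at hstep
  -- the slack inequality with the current queues as weights
  have hsl : ∑ n, lam n * ∫ ω, χ ω * Q t ω n ∂Pr + ∫ ω, ∑ n, ε n * (χ ω * Q t ω n) ∂Pr ≤
      ∫ ω, χ ω * S.meanMaxWeight ν φ (Q t ω) ∂Pr := by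
    have hiL : Integrable (fun ω => ∑ n, lam n * (χ ω * Q t ω n)) Pr :=
      integrable_finsetSum _ fun n _ => (hiQ n).const_mul _
    have hiE : Integrable (fun ω => ∑ n, ε n * (χ ω * Q t ω n)) Pr :=
      integrable_finsetSum _ fun n _ => (hiQ n).const_mul _
    have h1 : ∑ n, lam n * ∫ ω, χ ω * Q t ω n ∂Pr =
        ∫ ω, ∑ n, lam n * (χ ω * Q t ω n) ∂Pr := by
      rw [integral_finsetSum _ fun n _ => (hiQ n).const_mul _]
      simp only [integral_const_mul]
    rw [h1, ← integral_add hiL hiE]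
    refine integral_mono (hiL.add hiE) hi2 fun ω => ?_
    have h2 := mul_le_mul_of_nonneg_left (hslack (Q t ω) (hQ0 t ω)) (hχ0 ω)
    refine le_trans (le_of_eq ?_) h2
    simp only [Finset.mul_sum, ← Finset.sum_add_distrib]
    exact Finset.sum_congr rfl fun n _ => by ring
  linarith

end IsNetwork

/-! ### Stability and positive recurrence -/

/-- The bound is needed for `T ≥ 1` only: a limsup along `atTop` ignores the junk average at
`T = 0`. -/
lemma limsup_average_lt_top {x : ℕ → ℝ≥0∞} {C : ℝ}
    (hx : ∀ T : ℕ, 1 ≤ T → ∑ t ∈ Finset.range T, x t ≤ ENNReal.ofReal (C * T)) :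
    limsup (fun T : ℕ => (∑ t ∈ Finset.range T, x t) / (T : ℝ≥0∞)) atTop < ⊤ := by
  refine lt_of_le_of_lt (limsup_le_of_le (a := ENNReal.ofReal C) (by isBoundedDefault) ?_)
    ENNReal.ofReal_lt_top
  filter_upwards [eventually_ge_atTop 1] with T hT
  refine ENNReal.div_le_of_le_mul ((hx T hT).trans (le_of_eq ?_))
  rw [ENNReal.ofReal_mul' (Nat.cast_nonneg T), ENNReal.ofReal_natCast]

namespace IsNetwork

variable {Ω : Type*} [mΩ : MeasurableSpace Ω] {Pr : Measure Ω} {ν : Measure (Fin N → ℝ)}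
  {lam : Fin N → ℝ} {h a : ℕ → Ω → Fin N → ℝ} {S : HMSystem}
  {φ : (Fin N → ℝ) → (Fin N → ℝ) → Decision N}

lemma lintegral_randomQueue (net : IsNetwork Pr ν lam h a) (hν : S.IsChannelLaw ν)
    (hφ : S.IsMWHM φ) {q0 : Fin N → ℝ} (hq0 : ∀ n, 0 ≤ q0 n) (t : ℕ) (n : Fin N) :
    ∫⁻ ω, ENNReal.ofReal (S.randomQueue φ q0 h a t ω n) ∂Pr =
      ENNReal.ofReal (∫ ω, S.randomQueue φ q0 h a t ω n ∂Pr) := by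
  have := net.prob
  refine (ofReal_integral_eq_lintegral_ofReal ?_ ?_).symm
  · simpa using net.integrable_mul_randomQueue hν hφ hq0 t (integrable_const (1 : ℝ)) n
  · exact ae_of_all _ fun ω => S.ruleQueue_nonneg φ hq0 _ _ t n

/-- Users with positive slack have bounded mean queues on average: telescope the drift. -/
theorem limsup_lt_top_of_slack (net : IsNetwork Pr ν lam h a) (hν : S.IsChannelLaw ν)
    (hφ : S.IsMWHM φ) {ε : Fin N → ℝ} (hε : ∀ n, 0 ≤ ε n) (hslack : S.HasSlack ν φ lam ε)
    {q0 : Fin N → ℝ} (hq0 : ∀ n, 0 ≤ q0 n) {n : Fin N} (hn : 0 < ε n) :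
    limsup (fun T : ℕ => (∑ t ∈ Finset.range T,
      ∫⁻ ω, ENNReal.ofReal (S.randomQueue φ q0 h a t ω n) ∂Pr) / (T : ℝ≥0∞)) atTop < ⊤ := by
  have := net.prob
  obtain ⟨B, hB, hd⟩ := net.drift hν hφ hslack
  set Q := S.randomQueue φ q0 h a with hQdef
  have hQ0 : ∀ t ω n, 0 ≤ Q t ω n := fun t ω n => S.ruleQueue_nonneg φ hq0 _ _ t n
  have hiQ : ∀ t n, Integrable (fun ω => Q t ω n) Pr := fun t n => by
    simpa using net.integrable_mul_randomQueue hν hφ hq0 t (integrable_const (1 : ℝ)) n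
  have htel : ∀ T : ℕ, ∫ ω, ∑ k, Q T ω k ^ 2 ∂Pr +
      2 * ε n * ∑ t ∈ Finset.range T, ∫ ω, Q t ω n ∂Pr ≤ ∑ k, q0 k ^ 2 + B * T := by
    intro T
    induction T with
    | zero => simp [hQdef, randomQueue, ruleQueue]
    | succ T ih =>
      have h1 := hd q0 hq0 T (fun _ => 1) measurable_const (integrable_const _)
        fun _ => zero_le_one
      simp only [one_mul, integral_const, probReal_univ, smul_eq_mul, mul_one] at h1
      have h2 : ε n * ∫ ω, Q T ω n ∂Pr ≤ ∫ ω, ∑ k, ε k * Q T ω k ∂Pr := by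
        rw [← integral_const_mul]
        refine integral_mono ((hiQ T n).const_mul _)
          (integrable_finsetSum _ fun k _ => (hiQ T k).const_mul _) fun ω => ?_
        exact Finset.single_le_sum (f := fun k => ε k * Q T ω k)
          (fun k _ => mul_nonneg (hε k) (hQ0 T ω k)) (Finset.mem_univ n)
      rw [Finset.sum_range_succ]
      push_cast
      rw [← hQdef] at h1
      linarith
  refine limsup_average_lt_top (C := (∑ k, q0 k ^ 2 + B) / (2 * ε n)) fun T hT => ?_
  simp only [hQdef, net.lintegral_randomQueue hν hφ hq0]
  rw [← ENNReal.ofReal_sum_of_nonneg fun t _ => integral_nonneg fun ω => hQ0 t ω n]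
  refine ENNReal.ofReal_le_ofReal ?_
  have hV : 0 ≤ ∫ ω, ∑ k, Q T ω k ^ 2 ∂Pr :=
    integral_nonneg fun ω => Finset.sum_nonneg fun k _ => sq_nonneg _
  have hT' : (1 : ℝ) ≤ T := by exact_mod_cast hT
  have hV0 : 0 ≤ ∑ k, q0 k ^ 2 := Finset.sum_nonneg fun k _ => sq_nonneg _
  rw [div_mul_eq_mul_div, le_div_iff₀ (by positivity)]
  nlinarith [htel T, mul_nonneg hV0 (sub_nonneg.2 hT')]

end IsNetwork

/-- The event that the total queue length exceeds `R` in all slots `1, …, t`. -/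
def noReturn {Ω : Type*} (Q : ℕ → Ω → Fin N → ℝ) (R : ℝ) (t : ℕ) : Set Ω :=
  {ω | ∀ s ∈ Finset.Icc 1 t, R < ∑ n, Q s ω n}

lemma noReturn_antitone {Ω : Type*} (Q : ℕ → Ω → Fin N → ℝ) (R : ℝ) : Antitone (noReturn Q R) :=
  fun _ _ hst _ hω u hu => hω u (Finset.Icc_subset_Icc_right hst hu)

lemma noReturn_zero {Ω : Type*} (Q : ℕ → Ω → Fin N → ℝ) (R : ℝ) : noReturn Q R 0 = Set.univ := by
  ext ω; simp [noReturn]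

/-- The tail formula `E[τ] = ∑ t, P(τ > t)`, pathwise; `noReturn Q R t` is the event `τ > t`. -/
lemma returnTime_le_tsum {Ω : Type*} (Q : ℕ → Ω → Fin N → ℝ) (R : ℝ) (ω : Ω) :
    returnTime Q R ω ≤ ∑' t, (noReturn Q R t).indicator (fun _ => (1 : ℝ≥0∞)) ω := by
  classical
  by_cases hex : ∃ t, 1 ≤ t ∧ ∑ n, Q t ω n ≤ R
  · have h1 : returnTime Q R ω ≤ (Nat.find hex : ℝ≥0∞) :=
      biInf_le (fun t : ℕ => (t : ℝ≥0∞)) (Nat.find_spec hex)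
    refine h1.trans (le_trans (le_of_eq ?_) (ENNReal.sum_le_tsum (Finset.range (Nat.find hex))))
    rw [Finset.sum_congr rfl (g := fun _ => (1 : ℝ≥0∞))]
    · simp
    · intro t ht
      refine Set.indicator_of_mem (fun s hs => ?_) _
      rw [Finset.mem_Icc] at hs
      by_contra hle
      exact Nat.find_min hex (hs.2.trans_lt (Finset.mem_range.1 ht)) ⟨hs.1, not_lt.1 hle⟩
  · have h1 : ∀ t, (noReturn Q R t).indicator (fun _ => (1 : ℝ≥0∞)) ω = 1 := fun t =>
      Set.indicator_of_mem (fun s hs => by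
        by_contra hle
        exact hex ⟨s, (Finset.mem_Icc.1 hs).1, not_lt.1 hle⟩) _
    simp only [h1, ENNReal.tsum_const_eq_top_of_ne_zero one_ne_zero, le_top]

lemma measurableSet_noReturn {Ω : Type*} {h a : ℕ → Ω → Fin N → ℝ} {S : HMSystem}
    {φ : (Fin N → ℝ) → (Fin N → ℝ) → Decision N} (hφ : S.IsMWHM φ)
    (q0 : Fin N → ℝ) (R : ℝ) (t : ℕ) :
    MeasurableSet[past h a t] (noReturn (S.randomQueue φ q0 h a) R t) := by
  have h1 : noReturn (S.randomQueue φ q0 h a) R t =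
      ⋂ s ∈ Finset.Icc 1 t, {ω | R < ∑ n, S.randomQueue φ q0 h a s ω n} := by
    ext ω; simp [noReturn]
  rw [h1]
  refine Finset.measurableSet_biInter _ fun s hs => ?_
  refine past_mono h a (Finset.mem_Icc.1 hs).2 _ ?_
  have hm : Measurable[past h a s] fun ω => ∑ n, S.randomQueue φ q0 h a s ω n :=
    Finset.measurable_sum _ fun n _ =>
      (measurable_pi_apply n).comp (measurable_past_randomQueue hφ q0 s)
  exact hm measurableSet_Ioi

namespace IsNetwork

variable {Ω : Type*} [mΩ : MeasurableSpace Ω] {Pr : Measure Ω} {ν : Measure (Fin N → ℝ)}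
  {lam : Fin N → ℝ} {h a : ℕ → Ω → Fin N → ℝ} {S : HMSystem}
  {φ : (Fin N → ℝ) → (Fin N → ℝ) → Decision N}

/-- With a uniform slack `e`, the drift is at most `-1` outside `{q | ∑ n, q n ≤ R}` for
`2 * e * R = B + 1`, which bounds the mean return time (Foster's criterion). -/
theorem positiveRecurrent_of_slack (net : IsNetwork Pr ν lam h a) (hν : S.IsChannelLaw ν)
    (hφ : S.IsMWHM φ) {e : ℝ} (he : 0 < e) (hslack : S.HasSlack ν φ lam fun _ => e) :
    S.RulePositiveRecurrent Pr h a φ := by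
  have := net.prob
  obtain ⟨B, hB, hd⟩ := net.drift hν hφ hslack
  refine ⟨(B + 1) / (2 * e), fun b => ⟨b ^ 2 + B + 1, fun q0 hq0 hq0b => ?_⟩⟩
  set R := (B + 1) / (2 * e) with hR
  have hR2 : 2 * e * R = B + 1 := by rw [hR]; field_simp
  change ∫⁻ ω, returnTime (S.randomQueue φ q0 h a) R ω ∂Pr ≤ _
  set Q := S.randomQueue φ q0 h a with hQdef
  have hQ0 : ∀ t ω n, 0 ≤ Q t ω n := fun t ω n => S.ruleQueue_nonneg φ hq0 _ _ t n
  set χ : ℕ → Ω → ℝ := fun t => (noReturn Q R t).indicator fun _ => 1 with hχdef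
  have hms : ∀ t, MeasurableSet (noReturn Q R t) := fun t =>
    net.past_le t _ (measurableSet_noReturn hφ q0 R t)
  have hχm : ∀ t, Measurable[past h a t] (χ t) := fun t =>
    Measurable.indicator measurable_const (measurableSet_noReturn hφ q0 R t)
  have hχi : ∀ t, Integrable (χ t) Pr := fun t => (integrable_const 1).indicator (hms t)
  have hχ0 : ∀ t ω, 0 ≤ χ t ω := fun t ω => Set.indicator_nonneg (fun _ _ => zero_le_one) ω
  have hχp : ∀ t, ∫ ω, χ t ω ∂Pr = Pr.real (noReturn Q R t) := fun t =>
    integral_indicator_one (hms t)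
  have hV0 : ∑ n, q0 n ^ 2 ≤ b ^ 2 := by
    have h0 : ∑ n, q0 n ^ 2 ≤ (∑ n, q0 n) ^ 2 :=
      Finset.sum_sq_le_sq_sum_of_nonneg fun n _ => hq0 n
    exact h0.trans (pow_le_pow_left₀ (Finset.sum_nonneg fun n _ => hq0 n) hq0b 2)
  have hmono : ∀ t, ∫ ω, χ (t + 1) ω * ∑ n, Q (t + 1) ω n ^ 2 ∂Pr ≤
      ∫ ω, χ t ω * ∑ n, Q (t + 1) ω n ^ 2 ∂Pr := fun t => by
    refine integral_mono (net.integrable_mul_sq hν hφ hq0 (t + 1) (hχi _))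
      (net.integrable_mul_sq hν hφ hq0 (t + 1) (hχi _)) fun ω => ?_
    exact mul_le_mul_of_nonneg_right (Set.indicator_le_indicator_of_subset
      (noReturn_antitone Q R t.le_succ) (fun _ => zero_le_one) ω)
      (Finset.sum_nonneg fun n _ => sq_nonneg _)
  have hnn : ∀ t ω, 0 ≤ ∑ n, e * (χ t ω * Q t ω n) := fun t ω =>
    Finset.sum_nonneg fun n _ => mul_nonneg he.le (mul_nonneg (hχ0 t ω) (hQ0 t ω n))
  have hsum : ∀ T : ℕ, ∫ ω, χ T ω * ∑ n, Q T ω n ^ 2 ∂Pr +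
      ∑ t ∈ Finset.range T, Pr.real (noReturn Q R t) ≤ b ^ 2 + B + 1 := by
    intro T
    induction T with
    | zero =>
      have h1 : ∀ ω, χ 0 ω * ∑ n, Q 0 ω n ^ 2 = ∑ n, q0 n ^ 2 := fun ω => by
        simp [hχdef, noReturn_zero, hQdef, randomQueue, ruleQueue]
      simp only [h1, integral_const, probReal_univ, one_smul, Finset.range_zero,
        Finset.sum_empty]
      linarith
    | succ T ih =>
      have h1 := hd q0 hq0 T (χ T) (hχm T) (hχi T) (hχ0 T)
      rw [← hQdef, hχp] at h1
      have h2 := hmono T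
      rw [Finset.sum_range_succ]
      -- slot `0` needs its own bound: `noReturn` does not constrain the initial queues
      rcases Nat.eq_zero_or_pos T with rfl | hT
      · have h3 : 0 ≤ ∫ ω, ∑ n, e * (χ 0 ω * Q 0 ω n) ∂Pr := integral_nonneg (hnn 0)
        have h4 : Pr.real (noReturn Q R 0) = 1 := by simp [noReturn_zero]
        have h5 : ∀ ω, χ 0 ω * ∑ n, Q 0 ω n ^ 2 = ∑ n, q0 n ^ 2 := fun ω => by
          simp [hχdef, noReturn_zero, hQdef, randomQueue, ruleQueue]
        simp only [h5, integral_const, probReal_univ, one_smul, h4] at h1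
        simp only [Finset.range_zero, Finset.sum_empty, h4]
        linarith
      · have h3 : (e * R) * Pr.real (noReturn Q R T) ≤
            ∫ ω, ∑ n, e * (χ T ω * Q T ω n) ∂Pr := by
          rw [← hχp, ← integral_const_mul]
          refine integral_mono ((hχi T).const_mul _) (integrable_finsetSum _ fun n _ =>
            (net.integrable_mul_randomQueue hν hφ hq0 T (hχi T) n).const_mul _) fun ω => ?_
          simp only [← Finset.mul_sum]
          rw [mul_assoc]
          refine mul_le_mul_of_nonneg_left ?_ he.le
          by_cases hω : ω ∈ noReturn Q R T
          · simp only [hχdef, Set.indicator_of_mem hω, mul_one, one_mul]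
            exact (hω T (Finset.mem_Icc.2 ⟨hT, le_rfl⟩)).le
          · simp [hχdef, Set.indicator_of_notMem hω]
        have h4 : (B + 1) * Pr.real (noReturn Q R T) =
            2 * (e * R * Pr.real (noReturn Q R T)) := by rw [← hR2]; ring
        linarith
  calc ∫⁻ ω, returnTime Q R ω ∂Pr
      ≤ ∫⁻ ω, ∑' t, (noReturn Q R t).indicator (fun _ => (1 : ℝ≥0∞)) ω ∂Pr :=
        lintegral_mono fun ω => returnTime_le_tsum Q R ω
    _ = ∑' t, Pr (noReturn Q R t) := by
        rw [lintegral_tsum fun t => (measurable_const.indicator (hms t)).aemeasurable]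
        simp only [lintegral_indicator_const (hms _), one_mul]
    _ ≤ ENNReal.ofReal (b ^ 2 + B + 1) := by
        refine ENNReal.tsum_le_of_sum_range_le fun T => ?_
        rw [Finset.sum_congr rfl fun t _ => (ofReal_measureReal (μ := Pr)).symm,
          ← ENNReal.ofReal_sum_of_nonneg fun t _ => measureReal_nonneg]
        refine ENNReal.ofReal_le_ofReal ?_
        have hV : 0 ≤ ∫ ω, χ T ω * ∑ n, Q T ω n ^ 2 ∂Pr := integral_nonneg fun ω =>
          mul_nonneg (hχ0 T ω) (Finset.sum_nonneg fun n _ => sq_nonneg _)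
        linarith [hsum T]

end IsNetwork

/-! ### Outer bound on the rate region -/

lemma history_le {Ω : Type*} [mΩ : MeasurableSpace Ω] {U : Ω → ℝ} {h a : ℕ → Ω → Fin N → ℝ}
    (hU : Measurable U) (hh : ∀ t, Measurable (h t)) (ha : ∀ t, Measurable (a t)) (t : ℕ) :
    history U h a t ≤ mΩ :=
  sup_le (sup_le hU.comap_le (iSup₂_le fun s _ => (hh s).comap_le))
    (iSup₂_le fun s _ => (ha s).comap_le)

lemma ofReal_integral_le_lintegral {Ω : Type*} [MeasurableSpace Ω] {μ : Measure Ω} {f : Ω → ℝ}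
    (hf : Integrable f μ) : ENNReal.ofReal (∫ ω, f ω ∂μ) ≤ ∫⁻ ω, ENNReal.ofReal (f ω) ∂μ := by
  calc ENNReal.ofReal (∫ ω, f ω ∂μ)
      ≤ ENNReal.ofReal (∫ ω, max (f ω) 0 ∂μ) :=
        ENNReal.ofReal_le_ofReal (integral_mono hf hf.pos_part fun ω => le_max_left _ _)
    _ = ∫⁻ ω, ENNReal.ofReal (max (f ω) 0) ∂μ :=
        ofReal_integral_eq_lintegral_ofReal hf.pos_part (ae_of_all _ fun ω => le_max_right _ _)
    _ = ∫⁻ ω, ENNReal.ofReal (f ω) ∂μ := by simp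

/-- No policy offers more than the maximal weight, so along every admissible sample path the
weighted queues dominate the accumulated excess of arrivals over maximal service. -/
lemma sum_excess_le_queue (S : HMSystem) {φ : (Fin N → ℝ) → (Fin N → ℝ) → Decision N}
    (hφ : S.IsMWHM φ) {w q0 : Fin N → ℝ} (hw : ∀ n, 0 ≤ w n) (hq0 : ∀ n, 0 ≤ q0 n)
    {g a : ℕ → Fin N → ℝ} {d : ℕ → Decision N} (hg : ∀ t n, 0 ≤ g t n)
    (hd : ∀ t, S.Admissible (g t) (d t)) (T : ℕ) :
    ∑ t ∈ Finset.range T, (∑ n, w n * a t n - ∑ n, w n * S.service (g t) (φ w (g t)) n) ≤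
      ∑ n, w n * S.queue q0 g a d T n := by
  induction T with
  | zero =>
    rw [Finset.range_zero, Finset.sum_empty]
    exact Finset.sum_nonneg fun n _ => mul_nonneg (hw n) (hq0 n)
  | succ T ih =>
    rw [Finset.sum_range_succ]
    obtain ⟨h1, h2⟩ := hφ.2 w (g T) hw (hg T)
    have h3 := h2 _ (hd T)
    rw [S.weight_eq_sum _ _ h1, S.weight_eq_sum _ _ (hd T)] at h3
    have h4 : ∑ n, w n * S.queue q0 g a d T n + ∑ n, w n * a T n
        - ∑ n, w n * S.service (g T) (d T) n ≤ ∑ n, w n * S.queue q0 g a d (T + 1) n := by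
      rw [← Finset.sum_add_distrib, ← Finset.sum_sub_distrib]
      refine Finset.sum_le_sum fun n _ => ?_
      refine le_trans (le_of_eq (by ring)) (mul_le_mul_of_nonneg_left
        (S.le_step (S.queue q0 g a d T) (g T) (a T) (d T) n) (hw n))
    linarith

/-- If `∑ n, w n * lam n` exceeded the expected maximal weight by `Δ > 0`, the weighted mean queue
would be at least `t * Δ` in slot `t` under every policy, and its time averages would diverge. -/
theorem Stabilizable.sum_le_meanMaxWeight {S : HMSystem} {ν : Measure (Fin N → ℝ)}
    {lam : Fin N → ℝ} (hlam : S.Stabilizable ν lam) (hν : S.IsChannelLaw ν)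
    {φ : (Fin N → ℝ) → (Fin N → ℝ) → Decision N} (hφ : S.IsMWHM φ) {w : Fin N → ℝ}
    (hw : ∀ n, 0 ≤ w n) : ∑ n, w n * lam n ≤ S.meanMaxWeight ν φ w := by
  obtain ⟨Ω, mΩ, Pr, h, a, U, d, q0, net, pol, hq0, hst⟩ := hlam
  have := net.prob
  by_contra! hlt
  set Δ := ∑ n, w n * lam n - S.meanMaxWeight ν φ w with hΔ
  have hΔ0 : 0 < Δ := sub_pos.2 hlt
  set Q := fun (t : ℕ) (ω : Ω) =>
    S.queue q0 (fun s => h s ω) (fun s => a s ω) (fun s => d s ω) t with hQdef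
  obtain ⟨A, M, hAM⟩ := net.ae_bounds hν
  have hQm : ∀ t, Measurable (Q t) := fun t =>
    S.measurable_queue q0 net.meas_gain net.meas_arrival (fun s => (pol.causal s).mono
      (history_le pol.meas_seed net.meas_gain net.meas_arrival s) le_rfl) t
  have hQ0 : ∀ t ω n, 0 ≤ Q t ω n := fun t ω n => by
    cases t with
    | zero => exact hq0 n
    | succ t => exact S.step_nonneg _ _ _ _ _
  have hia : ∀ t n, Integrable (fun ω => a t ω n) Pr := fun t n => by
    refine Integrable.of_mem_Icc 0 A
      ((measurable_pi_apply n).comp (net.meas_arrival t)).aemeasurable ?_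
    filter_upwards [hAM] with ω hω
    exact (hω t).1 n
  have hiwa : ∀ t, Integrable (fun ω => ∑ n, w n * a t ω n) Pr := fun t =>
    integrable_finsetSum _ fun n _ => (hia t n).const_mul _
  have hmax := integrable_maxWeight hν hφ hw
  have hiws : ∀ t, Integrable (fun ω => ∑ n, w n * S.service (h t ω) (φ w (h t ω)) n) Pr :=
    fun t => by
      rw [← net.law_gain t] at hmax
      exact hmax.comp_measurable (net.meas_gain t)
  have hG : ∀ t, ∫ ω, (∑ n, w n * a t ω n - ∑ n, w n * S.service (h t ω) (φ w (h t ω)) n) ∂Pr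
      = Δ := fun t => by
    rw [integral_sub (hiwa t) (hiws t), integral_finsetSum _ fun n _ => (hia t n).const_mul _, hΔ]
    simp only [integral_const_mul, net.mean_arrival]
    congr 1
    unfold meanMaxWeight
    have hm := hmax.aestronglyMeasurable
    rw [← net.law_gain t] at hm ⊢
    exact (integral_map (net.meas_gain t).aemeasurable hm).symm
  have hiG : ∀ t, Integrable (fun ω => ∑ n, w n * a t ω n
      - ∑ n, w n * S.service (h t ω) (φ w (h t ω)) n) Pr := fun t => (hiwa t).sub (hiws t)
  have hlow : ∀ T : ℕ, ENNReal.ofReal (T * Δ) ≤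
      ∑ n, ENNReal.ofReal (w n) * ∫⁻ ω, ENNReal.ofReal (Q T ω n) ∂Pr := fun T => by
    calc ENNReal.ofReal (T * Δ)
        = ENNReal.ofReal (∫ ω, ∑ t ∈ Finset.range T, (∑ n, w n * a t ω n
            - ∑ n, w n * S.service (h t ω) (φ w (h t ω)) n) ∂Pr) := by
          rw [integral_finsetSum _ fun t _ => hiG t]
          simp [hG]
      _ ≤ ∫⁻ ω, ENNReal.ofReal (∑ t ∈ Finset.range T, (∑ n, w n * a t ω n
            - ∑ n, w n * S.service (h t ω) (φ w (h t ω)) n)) ∂Pr :=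
          ofReal_integral_le_lintegral (integrable_finsetSum _ fun t _ => hiG t)
      _ ≤ ∫⁻ ω, ∑ n, ENNReal.ofReal (w n) * ENNReal.ofReal (Q T ω n) ∂Pr := by
          refine lintegral_mono_ae ?_
          filter_upwards [hAM, pol.admissible] with ω h1 h2
          refine (ENNReal.ofReal_le_ofReal (S.sum_excess_le_queue hφ hw hq0
            (fun t => (h1 t).2.1) h2 T)).trans (le_of_eq ?_)
          rw [ENNReal.ofReal_sum_of_nonneg fun n _ => mul_nonneg (hw n) (hQ0 T ω n)]
          exact Finset.sum_congr rfl fun n _ => ENNReal.ofReal_mul (hw n)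
      _ = ∑ n, ENNReal.ofReal (w n) * ∫⁻ ω, ENNReal.ofReal (Q T ω n) ∂Pr := by
          have hm : ∀ n, Measurable fun ω => ENNReal.ofReal (Q T ω n) := fun n =>
            ((measurable_pi_apply n).comp (hQm T)).ennreal_ofReal
          rw [lintegral_finsetSum _ fun n _ => (hm n).const_mul _]
          exact Finset.sum_congr rfl fun n _ => lintegral_const_mul _ (hm n)
  choose c hc1 hc2 using fun n => exists_between (hst n)
  have hev := eventually_all.2 fun n => eventually_lt_of_limsup_lt (hc1 n)
  set C : ℝ≥0∞ := ∑ n, ENNReal.ofReal (w n) * c n with hC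
  have hCtop : C ≠ ⊤ :=
    ENNReal.sum_ne_top.2 fun n _ => ENNReal.mul_ne_top ENNReal.ofReal_ne_top (hc2 n).ne
  obtain ⟨k, hk⟩ := exists_nat_gt (2 * C.toReal / Δ + 1)
  obtain ⟨T, hT, hTk, hT1⟩ :=
    (hev.and ((eventually_ge_atTop k).and (eventually_ge_atTop 1))).exists
  have hT0 : (T : ℝ≥0∞) ≠ 0 := by simp; omega
  have hup : ∑ t ∈ Finset.range T, ENNReal.ofReal (t * Δ) ≤ C * T := by
    calc ∑ t ∈ Finset.range T, ENNReal.ofReal (t * Δ)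
        ≤ ∑ t ∈ Finset.range T,
            ∑ n, ENNReal.ofReal (w n) * ∫⁻ ω, ENNReal.ofReal (Q t ω n) ∂Pr :=
          Finset.sum_le_sum fun t _ => hlow t
      _ = ∑ n, ENNReal.ofReal (w n) *
            ∑ t ∈ Finset.range T, ∫⁻ ω, ENNReal.ofReal (Q t ω n) ∂Pr := by
          rw [Finset.sum_comm]
          simp only [Finset.mul_sum]
      _ ≤ ∑ n, ENNReal.ofReal (w n) * (c n * T) := by
          refine Finset.sum_le_sum fun n _ => mul_le_mul_right ?_ _
          exact (ENNReal.div_le_iff hT0 (ENNReal.natCast_ne_top T)).1 (hT n).le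
      _ = C * T := by simp only [hC, Finset.sum_mul, mul_assoc]
  rw [← ENNReal.ofReal_sum_of_nonneg fun t _ => by positivity, ← ENNReal.ofReal_toReal hCtop,
    ← ENNReal.ofReal_natCast, ← ENNReal.ofReal_mul ENNReal.toReal_nonneg,
    ENNReal.ofReal_le_ofReal_iff (by positivity), ← Finset.sum_mul] at hup
  have hsum : (∑ t ∈ Finset.range T, (t : ℝ)) * 2 = T * (T - 1) := by
    have h1 := Finset.sum_range_id_mul_two T
    have h2 : ((T - 1 : ℕ) : ℝ) = T - 1 := by rw [Nat.cast_sub hT1, Nat.cast_one]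
    rw [← h2, ← Nat.cast_mul, ← h1]
    push_cast
    rfl
  have hTk' : (k : ℝ) ≤ T := by exact_mod_cast hTk
  have hTpos : (0 : ℝ) < T := by exact_mod_cast hT1
  have h1 : 2 * C.toReal < (T - 1) * Δ := by
    rw [← div_lt_iff₀ hΔ0]; linarith
  have h2 : T * (2 * C.toReal) < T * ((T - 1) * Δ) := mul_lt_mul_of_pos_left h1 hTpos
  nlinarith

lemma sum_le_meanMaxWeight_of_mem_rateRegion {S : HMSystem} {ν : Measure (Fin N → ℝ)}
    (hν : S.IsChannelLaw ν) {φ : (Fin N → ℝ) → (Fin N → ℝ) → Decision N} (hφ : S.IsMWHM φ)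
    {lam : Fin N → ℝ} (hlam : lam ∈ S.rateRegion ν) {w : Fin N → ℝ} (hw : ∀ n, 0 ≤ w n) :
    ∑ n, w n * lam n ≤ S.meanMaxWeight ν φ w := by
  have hclosed : IsClosed {x : Fin N → ℝ | ∑ n, w n * x n ≤ S.meanMaxWeight ν φ w} :=
    isClosed_le (by fun_prop) continuous_const
  exact closure_minimal (fun x hx => Stabilizable.sum_le_meanMaxWeight hx hν hφ hw) hclosed hlam

/-! ### Comparison of the two regions -/

/-- A network with constant arrivals realizes every nonnegative rate vector, so a rule that
stabilizes all networks with these rates is a stabilizing policy. -/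
lemma stabilizable_of_rule {S : HMSystem} {ν : Measure (Fin N → ℝ)} (hν : S.IsChannelLaw ν)
    {φ : (Fin N → ℝ) → (Fin N → ℝ) → Decision N} (hφ : S.IsMWHM φ) {lam : Fin N → ℝ}
    (hlam : ∀ n, 0 ≤ lam n)
    (hst : ∀ (Ω : Type) (_ : MeasurableSpace Ω) (Pr : Measure Ω) (h a : ℕ → Ω → Fin N → ℝ),
      IsNetwork Pr ν lam h a → S.RuleStabilizes Pr h a φ) : S.Stabilizable ν lam := by
  have := hν.1
  obtain ⟨Ω, mΩ, Pr, h, hm, hlaw, hind, hprob⟩ := exists_iid ℕ ν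
  have net : IsNetwork Pr ν lam h fun _ _ => lam :=
    { prob := hprob
      meas_gain := hm
      meas_arrival := fun _ => measurable_const
      law_gain := fun t => (hlaw t).map_eq
      indep_gain := hind
      identDistrib_arrival := fun _ => IdentDistrib.refl aemeasurable_const
      indep_arrival := by
        rw [iIndepFun_iff_measure_inter_preimage_eq_mul]
        intro s B _
        by_cases hs : ∀ i ∈ s, lam ∈ B i
        · have h1 : ∀ i ∈ s, (fun _ : Ω => lam) ⁻¹' B i = Set.univ := fun i hi => by
            ext; simp [hs i hi]
          rw [Set.iInter₂_congr h1, Finset.prod_congr rfl fun i hi => by rw [h1 i hi]]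
          simp
        · push Not at hs
          obtain ⟨i, hi, hiB⟩ := hs
          have h1 : (fun _ : Ω => lam) ⁻¹' B i = ∅ := by ext; simp [hiB]
          rw [Finset.prod_eq_zero hi (by rw [h1, measure_empty])]
          exact measure_mono_null (Set.biInter_subset_of_mem hi) (by rw [h1, measure_empty])
      indep_gain_arrival := indepFun_const_right _ _
      bounded_arrival := ⟨∑ n, lam n, fun _ => ae_of_all _ fun _ n =>
        ⟨hlam n, Finset.single_le_sum (fun k _ => hlam k) (Finset.mem_univ n)⟩⟩
      mean_arrival := fun _ n => by simp }
  refine ⟨Ω, mΩ, Pr, h, fun _ _ => lam, fun _ => 0,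
    fun t ω => φ (S.randomQueue φ 0 h (fun _ _ => lam) t ω) (h t ω), 0, net, ?_,
    fun _ => le_rfl, ?_⟩
  · refine ⟨measurable_const, indepFun_const_left _ _, fun t => ?_, ?_⟩
    · have hg : ∀ s ≤ t, Measurable[history (fun _ => 0) h (fun _ _ => lam) t] (h s) :=
        fun s hs => Measurable.of_comap_le (le_sup_of_le_left (le_sup_of_le_right
          (le_iSup₂_of_le (f := fun i _ => MeasurableSpace.comap (h i) inferInstance) s hs
            le_rfl)))
      exact measurable_rule (m := history (fun _ => 0) h (fun _ _ => lam) t) hφ.1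
        (S.measurable_ruleQueue (m := history (fun _ => 0) h (fun _ _ => lam) t) hφ.1 0 t
          (fun s hs => hg s hs.le) fun _ _ => measurable_const) (hg t le_rfl)
    · obtain ⟨A, M, hAM⟩ := net.ae_bounds hν
      filter_upwards [hAM] with ω hω t
      exact (hφ.2 _ _ (S.ruleQueue_nonneg φ (fun _ => le_rfl) _ _ t) (hω t).2.1).1
  · have h1 := hst Ω mΩ Pr h _ net 0 fun _ => le_rfl
    refine Eq.mp (congrArg (StronglyStable Pr) ?_) h1
    funext t ω
    exact S.ruleQueue_eq_queue φ 0 _ _ t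

lemma Stabilizable.nonneg {S : HMSystem} {ν : Measure (Fin N → ℝ)} {lam : Fin N → ℝ}
    (hlam : S.Stabilizable ν lam) (n : Fin N) : 0 ≤ lam n := by
  obtain ⟨Ω, mΩ, Pr, h, a, U, d, q0, net, -⟩ := hlam
  obtain ⟨A, hA⟩ := net.bounded_arrival
  rw [← net.mean_arrival 0 n]
  refine integral_nonneg_of_ae ?_
  filter_upwards [hA 0] with ω hω
  exact (hω n).1

/-- A user with arrival rate `0` receives no arrivals, so its queue never grows. -/
lemma IsNetwork.limsup_lt_top_of_rate_zero {Ω : Type*} [MeasurableSpace Ω] {Pr : Measure Ω}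
    {ν : Measure (Fin N → ℝ)} {lam : Fin N → ℝ} {h a : ℕ → Ω → Fin N → ℝ} {S : HMSystem}
    {φ : (Fin N → ℝ) → (Fin N → ℝ) → Decision N} (net : IsNetwork Pr ν lam h a)
    (hν : S.IsChannelLaw ν) (hφ : S.IsMWHM φ) {q0 : Fin N → ℝ} (hq0 : ∀ n, 0 ≤ q0 n)
    {n : Fin N} (hn : lam n = 0) :
    limsup (fun T : ℕ => (∑ t ∈ Finset.range T,
      ∫⁻ ω, ENNReal.ofReal (S.randomQueue φ q0 h a t ω n) ∂Pr) / (T : ℝ≥0∞)) atTop < ⊤ := by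
  have := net.prob
  obtain ⟨A, M, hAM⟩ := net.ae_bounds hν
  have hzero : ∀ᵐ ω ∂Pr, ∀ t, a t ω n = 0 := ae_all_iff.2 fun t => by
    have hbd : ∀ᵐ ω ∂Pr, a t ω n ∈ Set.Icc 0 A := by
      filter_upwards [hAM] with ω hω
      exact (hω t).1 n
    have hi := Integrable.of_mem_Icc 0 A
      ((measurable_pi_apply n).comp (net.meas_arrival t)).aemeasurable hbd
    exact (integral_eq_zero_iff_of_nonneg_ae (hbd.mono fun ω hω => hω.1) hi).1
      ((net.mean_arrival t n).trans hn)
  have hle : ∀ᵐ ω ∂Pr, ∀ t, S.randomQueue φ q0 h a t ω n ≤ q0 n := by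
    filter_upwards [hAM, hzero] with ω hω hz t
    induction t with
    | zero => exact le_rfl
    | succ t ih =>
      have hq := S.ruleQueue_nonneg φ hq0 (fun s => h s ω) (fun s => a s ω) t
      refine (S.step_le (hq n) ((hω t).1 n).1
        (S.service_nonneg (hω t).2.1 (hφ.2 _ _ hq (hω t).2.1).1 n)).trans ?_
      rw [hz t, add_zero]
      exact ih
  refine limsup_average_lt_top (C := q0 n) fun T _ => ?_
  calc ∑ t ∈ Finset.range T, ∫⁻ ω, ENNReal.ofReal (S.randomQueue φ q0 h a t ω n) ∂Pr
      ≤ ∑ _t ∈ Finset.range T, ENNReal.ofReal (q0 n) := Finset.sum_le_sum fun t _ => by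
        refine (lintegral_mono_ae (hle.mono fun ω hω =>
          ENNReal.ofReal_le_ofReal (hω t))).trans (le_of_eq ?_)
        simp
    _ = ENNReal.ofReal (q0 n * T) := by
        rw [ENNReal.ofReal_mul (hq0 n), ENNReal.ofReal_natCast]
        simp [mul_comm]

/-- Shrinking a stabilizable rate vector gains slack `δ / N * meanMaxWeight (e_n)` for user `n`:
`meanMaxWeight w` is at least the average over `n` of `w n * meanMaxWeight (e_n)`. -/
lemma Stabilizable.hasSlack_smul {S : HMSystem} {ν : Measure (Fin N → ℝ)} {lam : Fin N → ℝ}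
    (hlam : S.Stabilizable ν lam) (hν : S.IsChannelLaw ν)
    {φ : (Fin N → ℝ) → (Fin N → ℝ) → Decision N} (hφ : S.IsMWHM φ) (hN : 0 < N) {δ : ℝ}
    (hδ0 : 0 ≤ δ) (hδ1 : δ ≤ 1) :
    S.HasSlack ν φ ((1 - δ) • lam) fun n => δ / N * S.meanMaxWeight ν φ (Pi.single n 1) := by
  intro w hw
  have hN' : (0 : ℝ) < N := by exact_mod_cast hN
  have h1 := hlam.sum_le_meanMaxWeight hν hφ hw
  have h2 : ∑ n, w n * S.meanMaxWeight ν φ (Pi.single n 1) ≤ N * S.meanMaxWeight ν φ w := by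
    refine (Finset.sum_le_sum fun n _ => le_meanMaxWeight hν hφ hw n).trans (le_of_eq ?_)
    simp
  have h3 : δ / N * ∑ n, w n * S.meanMaxWeight ν φ (Pi.single n 1) ≤
      δ * S.meanMaxWeight ν φ w := by
    refine (mul_le_mul_of_nonneg_left h2 (by positivity)).trans (le_of_eq ?_)
    field_simp
  calc ∑ n, w n * (((1 - δ) • lam) n + δ / N * S.meanMaxWeight ν φ (Pi.single n 1))
      = (1 - δ) * ∑ n, w n * lam n
          + δ / N * ∑ n, w n * S.meanMaxWeight ν φ (Pi.single n 1) := by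
        rw [Finset.mul_sum, Finset.mul_sum, ← Finset.sum_add_distrib]
        refine Finset.sum_congr rfl fun n _ => ?_
        simp only [Pi.smul_apply, smul_eq_mul]
        ring
    _ ≤ (1 - δ) * S.meanMaxWeight ν φ w + δ * S.meanMaxWeight ν φ w :=
        add_le_add (mul_le_mul_of_nonneg_left h1 (sub_nonneg.2 hδ1)) h3
    _ = S.meanMaxWeight ν φ w := by ring

lemma Stabilizable.ruleStabilizes_smul {S : HMSystem} {ν : Measure (Fin N → ℝ)}
    {lam : Fin N → ℝ} (hlam : S.Stabilizable ν lam) (hν : S.IsChannelLaw ν)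
    {φ : (Fin N → ℝ) → (Fin N → ℝ) → Decision N} (hφ : S.IsMWHM φ) {δ : ℝ}
    (hδ0 : 0 < δ) (hδ1 : δ ≤ 1) {Ω : Type*} [MeasurableSpace Ω] {Pr : Measure Ω}
    {h a : ℕ → Ω → Fin N → ℝ} (net : IsNetwork Pr ν ((1 - δ) • lam) h a) :
    S.RuleStabilizes Pr h a φ := by
  intro q0 hq0 n
  have hN : 0 < N := n.pos
  have hN' : (0 : ℝ) < N := by exact_mod_cast hN
  have hW : ∀ k : Fin N, 0 ≤ S.meanMaxWeight ν φ (Pi.single k 1) := fun k =>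
    meanMaxWeight_nonneg hν hφ (single_one_nonneg k)
  rcases (hW n).eq_or_lt with h0 | hpos
  · -- a user that can never be served has rate `0`
    refine net.limsup_lt_top_of_rate_zero hν hφ hq0 ?_
    have h1 := hlam.sum_le_meanMaxWeight hν hφ (single_one_nonneg n)
    have h2 : lam n = 0 := by
      refine le_antisymm ?_ (hlam.nonneg n)
      rw [← h0] at h1
      simpa [Pi.single_apply] using h1
    simp [h2]
  · exact net.limsup_lt_top_of_slack hν hφ (fun k => mul_nonneg (by positivity) (hW k))
      (hlam.hasSlack_smul hν hφ hN hδ0.le hδ1) hq0 (mul_pos (by positivity) hpos)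

theorem ruleRegion_eq_rateRegion {S : HMSystem} {ν : Measure (Fin N → ℝ)}
    (hν : S.IsChannelLaw ν) {φ : (Fin N → ℝ) → (Fin N → ℝ) → Decision N} (hφ : S.IsMWHM φ) :
    S.ruleRegion ν φ = S.rateRegion ν := by
  refine Set.Subset.antisymm
    (closure_mono fun lam hlam => stabilizable_of_rule hν hφ hlam.1 hlam.2)
    (closure_minimal (fun lam hlam => ?_) isClosed_closure)
  have hlim : Tendsto (fun k : ℕ => (1 - 1 / ((k : ℝ) + 1)) • lam) atTop (nhds lam) := by
    have h1 := (tendsto_const_nhds (x := (1 : ℝ))).sub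
      (tendsto_one_div_add_atTop_nhds_zero_nat (𝕜 := ℝ))
    simpa using h1.smul_const lam
  refine mem_closure_of_tendsto hlim (Eventually.of_forall fun k => ?_)
  have hk0 : (0 : ℝ) < 1 / ((k : ℝ) + 1) := by positivity
  have hk1 : 1 / ((k : ℝ) + 1) ≤ 1 := by
    rw [div_le_one (by positivity)]
    linarith [Nat.cast_nonneg (α := ℝ) k]
  exact ⟨fun n => mul_nonneg (sub_nonneg.2 hk1) (Stabilizable.nonneg hlam n),
    fun Ω _ Pr h a net => Stabilizable.ruleStabilizes_smul hlam hν hφ hk0 hk1 net⟩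

end HMSystem

end

theorem lemma2 {N : ℕ} (hN : 2 ≤ N) (S : HMSystem) (ν : Measure (Fin N → ℝ))
    (hν : S.IsChannelLaw ν)
    (φ : (Fin N → ℝ) → (Fin N → ℝ) → HMSystem.Decision N) (hφ : S.IsMWHM φ) :
    (∀ lam : Fin N → ℝ, (∃ ε : ℝ, 0 < ε ∧ (fun n => lam n + ε) ∈ S.rateRegion ν) →
      ∀ (Ω : Type*) (_ : MeasurableSpace Ω) (Pr : Measure Ω) (h a : ℕ → Ω → Fin N → ℝ),
        HMSystem.IsNetwork Pr ν lam h a →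
          S.RuleStabilizes Pr h a φ ∧ S.RulePositiveRecurrent Pr h a φ) ∧
    S.ruleRegion ν φ = S.rateRegion ν := by
  refine ⟨fun lam ⟨ε, hε, hmem⟩ Ω _ Pr h a net => ?_, HMSystem.ruleRegion_eq_rateRegion hν hφ⟩
  have hslack : S.HasSlack ν φ lam fun _ => ε := fun w hw =>
    HMSystem.sum_le_meanMaxWeight_of_mem_rateRegion hν hφ hmem hw
  exact ⟨fun q0 hq0 n => net.limsup_lt_top_of_slack hν hφ (fun _ => hε.le) hslack hq0 hε,
    net.positiveRecurrent_of_slack hν hφ hε hslack⟩
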